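/- Let $n\ge 2$, let $\Omega\subset\mathbb{R}^n$ be open, bounded and connected (and non-empty), and for $\delta>0$ let $\Omega_\delta=\bigcup_{x\in\Omega}B(x,\delta)$, where $B(x,\delta)$ is the open ball. For every $\delta>0$ let $A_\delta:[0,\infty)\to[0,\infty)$ be a kernel such that $$\frac1n\int_{\mathbb{R}^n}A_\delta(|x|)\,dx=1,\qquad A_\delta(|x|)=0\ \text{ for } x\notin B(0,\delta),$$ and suppose there are $s\in(0,1)$ and constants $c_\delta>0$ with $A_\delta(|x|)\ge c_\delta|x|^{-(n+2s-2)}$ for all $\delta>0$ and all $x\in B(0,\delta/2)\setminus\{0\}$. Put $$a_{\delta,1}(u,u)=\int_{\Omega_\delta}\int_{\Omega_\delta}A_\delta(|x-x'|)\frac{(u(x)-u(x'))^2}{|x-x'|^2}\,dx'\,dx,\qquad \mathcal U^\delta=\{u\in L^2(\Omega_\delta): a_{\delta,1}(u,u)<\infty\}.$$ Let $\mathcal U_0^\delta$ be the closure of $C_c^\infty(\Omega)$ (functions extended by $0$ outside $\Omega$) in $\mathcal U^\delta$ for the norm $\big(\|u\|_{L^2(\Omega_\delta)}^2+a_{\delta,1}(u,u)\big)^{1/2}$,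 and equip it with $\|u\|_{\mathcal U_0^\delta}=a_{\delta,1}(u,u)^{1/2}$. Lemma. For every $\delta_0>0$ there are $\hat\delta\in(0,\delta_0)$ and $C>0$, independent of $\delta$ and $u$, such that $$C\,\|u\|_{L^2(\Omega)}\le\|u\|_{\mathcal U_0^\delta}\qquad\text{for all }\delta\in(0,\hat\delta)\text{ and all }u\in\mathcal U_0^\delta .$$ -/

import Mathlib

open MeasureTheory
open scoped ENNReal ContDiff

/-- The space `ℝⁿ` with its Euclidean norm. -/
abbrev RSpace (n : ℕ) : Type := EuclideanSpace ℝ (Fin n)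

/-- `Ω_δ`, the union of the open balls of radius `δ` centred at the points of `Ω`. -/
def nlDomain {n : ℕ} (Ω : Set (RSpace n)) (δ : ℝ) : Set (RSpace n) :=
  ⋃ x ∈ Ω, Metric.ball x δ

/-- The standing assumptions on a family of radial kernels `A_δ : ℝ₊ → ℝ₊`, `δ > 0`.
Since the Bochner integral of a non-integrable function is `0`, the normalisation contains the
(a.e.) measurability and the integrability of `x ↦ A_δ(|x|)`. -/
structure IsAdmissibleKernel (n : ℕ) (A : ℝ → ℝ → ℝ) : Prop where
  nonneg : ∀ δ > 0, ∀ r ≥ 0, 0 ≤ A δ r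
  normalized : ∀ δ > 0, (1 / (n : ℝ)) * ∫ x : RSpace n, A δ ‖x‖ = 1
  support_subset : ∀ δ > 0, Function.support (fun x : RSpace n => A δ ‖x‖) ⊆ Metric.ball 0 δ
  lower_bound : ∃ s : ℝ, 0 < s ∧ s < 1 ∧ ∀ δ > 0, ∃ c > 0,
    ∀ x ∈ Metric.ball (0 : RSpace n) (δ / 2) \ {0},
      c / ‖x‖ ^ ((n : ℝ) + 2 * s - 2) ≤ A δ ‖x‖

/-- The quadratic form
`a_{δ,1}(u,u) = ∫_{Ω_δ} ∫_{Ω_δ} A_δ(|x-x'|) (u(x)-u(x'))² / |x-x'|² dx' dx`,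
with values in `[0, ∞]`. -/
noncomputable def nlEnergy {n : ℕ} (A : ℝ → ℝ → ℝ) (Ω : Set (RSpace n)) (δ : ℝ)
    (u : RSpace n → ℝ) : ℝ≥0∞ :=
  ∫⁻ x in nlDomain Ω δ, ∫⁻ x' in nlDomain Ω δ,
    ENNReal.ofReal (A δ ‖x - x'‖ * ((u x - u x') / ‖x - x'‖) ^ 2)

/-- `U^δ`: the functions `u ∈ L²(Ω_δ)` with `a_{δ,1}(u,u) < ∞`. Functions are represented by maps
on `ℝⁿ` whose values outside `Ω_δ` play no role. -/
def nlSpace {n : ℕ} (A : ℝ → ℝ → ℝ) (Ω : Set (RSpace n)) (δ : ℝ) : Set (RSpace n → ℝ) :=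
  {u | MemLp u 2 (volume.restrict (nlDomain Ω δ)) ∧ nlEnergy A Ω δ u < ⊤}

/-- `C^∞_c(Ω)`, each function being extended by `0` outside `Ω`. -/
def testFunctions {n : ℕ} (Ω : Set (RSpace n)) : Set (RSpace n → ℝ) :=
  {φ | ContDiff ℝ ∞ φ ∧ HasCompactSupport φ ∧ tsupport φ ⊆ Ω}

/-- `U_0^δ`: the closure of `C^∞_c(Ω)` in `U^δ`, whose topology is that of the norm
`(‖u‖²_{L²(Ω_δ)} + a_{δ,1}(u,u))^{1/2}`. -/
def nlSpaceZero {n : ℕ} (A : ℝ → ℝ → ℝ) (Ω : Set (RSpace n)) (δ : ℝ) : Set (RSpace n → ℝ) :=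
  {u | u ∈ nlSpace A Ω δ ∧ ∀ ε : ℝ≥0∞, 0 < ε → ∃ φ ∈ testFunctions Ω,
    eLpNorm (u - φ) 2 (volume.restrict (nlDomain Ω δ)) ^ 2 + nlEnergy A Ω δ (u - φ) < ε}

/-- The norm `‖u‖_{U_0^δ} = a_{δ,1}(u,u)^{1/2}` (the energy is finite on `U^δ`). -/
noncomputable def nlNorm {n : ℕ} (A : ℝ → ℝ → ℝ) (Ω : Set (RSpace n)) (δ : ℝ)
    (u : RSpace n → ℝ) : ℝ :=
  Real.sqrt (nlEnergy A Ω δ u).toReal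

/-- The norm of `L²(Ω)` (finite for `u ∈ U^δ`, since `Ω ⊆ Ω_δ`). -/
noncomputable def l2Norm {n : ℕ} (Ω : Set (RSpace n)) (u : RSpace n → ℝ) : ℝ :=
  (eLpNorm u 2 (volume.restrict Ω)).toReal

/-!
A function `u` in `U_0^δ` vanishes almost everywhere on `Ω_δ \ Ω`, so it may be replaced by a
measurable function `v` on `ℝⁿ` that vanishes off `Ω` (`exists_measurable_eq_zero_off`). As the
kernel has range `δ`, the energy of `v` is then the integral over all of `ℝⁿ × ℝⁿ`, and Tonelli's
theorem together with the substitution `h = x - x'` turns it into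
`∫ A_δ(|h|) |h|⁻² ‖v - v(· - h)‖² dh` (`nlEnergy_eq_lintegral_translation`).

Each translation satisfies a Poincaré inequality by itself. If `N |h|` exceeds the diameter of `Ω`,
the supports of `v` and `v(· - N h)` are disjoint, so
`‖v‖ ≤ ‖v - v(· - N h)‖ ≤ N ‖v - v(· - h)‖`. The least such `N` has `N |h| ≤ diam Ω + |h|`, whence
`|h| ‖v‖ ≤ (diam Ω + δ₀) ‖v - v(· - h)‖` for `|h| ≤ δ₀` (`norm_mul_eLpNorm_le_translation`).
Integrating the square of this against `A_δ(|h|) |h|⁻²` and using `∫ A_δ(|h|) dh = n ≥ 1` gives the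
estimate with `C = 1 / (diam Ω + δ₀)` (`eLpNorm_sq_le_nlEnergy`).
-/

/-- Translating `N` times costs at most `N` times the cost of translating once. -/
lemma eLpNorm_sub_translation_nsmul_le {n : ℕ} {v : RSpace n → ℝ} (hv : Measurable v)
    (h : RSpace n) (N : ℕ) :
    eLpNorm (fun x => v x - v (x - N • h)) 2 volume
      ≤ N * eLpNorm (fun x => v x - v (x - h)) 2 volume := by
  induction N with
  | zero => simp
  | succ N ih =>
    have hsplit : (fun x => v x - v (x - (N + 1) • h))
        = (fun x => v x - v (x - N • h))
          + (fun x => v x - v (x - h)) ∘ (fun x => x - N • h) := by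
      funext x
      simp [add_smul, sub_sub]
    have hm : ∀ k : RSpace n, Measurable fun x => v x - v (x - k) := fun k =>
      hv.sub (hv.comp (measurable_id.sub_const k))
    rw [hsplit]
    refine (eLpNorm_add_le (hm _).aestronglyMeasurable
      ((hm h).comp (measurable_sub_const (N • h))).aestronglyMeasurable (by norm_num)).trans ?_
    rw [eLpNorm_comp_measurePreserving (hm h).aestronglyMeasurable
      (measurePreserving_sub_right volume (N • h))]
    push_cast
    rw [add_mul, one_mul]
    gcongr

/-- Poincaré inequality for a single translation. -/
lemma norm_mul_eLpNorm_le_translation {n : ℕ} {Ω : Set (RSpace n)} (hΩb : Bornology.IsBounded Ω)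
    {v : RSpace n → ℝ} (hv : Measurable v) (hv0 : ∀ x ∉ Ω, v x = 0) {r : ℝ} {h : RSpace n}
    (hr : ‖h‖ ≤ r) :
    ENNReal.ofReal ‖h‖ * eLpNorm v 2 volume
      ≤ ENNReal.ofReal (Metric.diam Ω + r) * eLpNorm (fun x => v x - v (x - h)) 2 volume := by
  rcases eq_or_ne h 0 with rfl | hne
  · simp
  have hpos : 0 < ‖h‖ := norm_pos_iff.2 hne
  set N : ℕ := ⌊Metric.diam Ω / ‖h‖⌋₊ + 1 with hN
  have hlt : Metric.diam Ω < N * ‖h‖ := by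
    rw [← div_lt_iff₀ hpos, hN]
    push_cast
    exact Nat.lt_floor_add_one _
  have hle : N * ‖h‖ ≤ Metric.diam Ω + r := by
    have h1 : (⌊Metric.diam Ω / ‖h‖⌋₊ : ℝ) * ‖h‖ ≤ Metric.diam Ω :=
      (le_div_iff₀ hpos).1 (Nat.floor_le (div_nonneg Metric.diam_nonneg hpos.le))
    rw [hN]
    push_cast
    linarith
  have hdisj : eLpNorm v 2 volume ≤ eLpNorm (fun x => v x - v (x - N • h)) 2 volume := by
    refine eLpNorm_mono fun x => ?_
    by_cases hx : x ∈ Ω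
    · have hx' : x - N • h ∉ Ω := fun hx' => by
        have := Metric.dist_le_diam_of_mem hΩb hx hx'
        rw [dist_eq_norm, sub_sub_cancel, ← Nat.cast_smul_eq_nsmul ℝ, norm_smul,
          Real.norm_natCast] at this
        linarith
      simp [hv0 _ hx']
    · simp [hv0 _ hx]
  calc ENNReal.ofReal ‖h‖ * eLpNorm v 2 volume
      ≤ ENNReal.ofReal ‖h‖ * (N * eLpNorm (fun x => v x - v (x - h)) 2 volume) := by
        gcongr
        exact hdisj.trans (eLpNorm_sub_translation_nsmul_le hv h N)
    _ = ENNReal.ofReal (N * ‖h‖) * eLpNorm (fun x => v x - v (x - h)) 2 volume := by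
        rw [ENNReal.ofReal_mul (Nat.cast_nonneg N), ENNReal.ofReal_natCast]
        ring
    _ ≤ _ := by gcongr

lemma subset_nlDomain {n : ℕ} {Ω : Set (RSpace n)} {δ : ℝ} (hδ : 0 < δ) :
    Ω ⊆ nlDomain Ω δ := fun _ hx => Set.mem_biUnion hx (Metric.mem_ball_self hδ)

lemma isOpen_nlDomain {n : ℕ} (Ω : Set (RSpace n)) (δ : ℝ) : IsOpen (nlDomain Ω δ) :=
  isOpen_biUnion fun _ _ => Metric.isOpen_ball

lemma nlEnergy_congr_ae {n : ℕ} {A : ℝ → ℝ → ℝ} {Ω : Set (RSpace n)} {δ : ℝ}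
    {u v : RSpace n → ℝ} (huv : u =ᵐ[volume.restrict (nlDomain Ω δ)] v) :
    nlEnergy A Ω δ u = nlEnergy A Ω δ v := by
  refine lintegral_congr_ae ?_
  filter_upwards [huv] with x hx
  refine lintegral_congr_ae ?_
  filter_upwards [huv] with x' hx'
  rw [hx, hx']

/-- Test functions vanish off `Ω`, and this passes to `L²` limits. -/
lemma ae_eq_zero_of_mem_nlSpaceZero {n : ℕ} {A : ℝ → ℝ → ℝ} {Ω : Set (RSpace n)}
    (hΩ : MeasurableSet Ω) {δ : ℝ} {u : RSpace n → ℝ} (hu : u ∈ nlSpaceZero A Ω δ) :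
    u =ᵐ[volume.restrict (nlDomain Ω δ \ Ω)] 0 := by
  have hmono : volume.restrict (nlDomain Ω δ \ Ω) ≤ volume.restrict (nlDomain Ω δ) :=
    Measure.restrict_mono Set.sdiff_subset le_rfl
  rw [← eLpNorm_eq_zero_iff (hu.1.1.1.mono_measure hmono) two_ne_zero, ← pow_eq_zero_iff two_ne_zero,
    ← nonpos_iff_eq_zero]
  refine le_of_forall_gt fun ε hε => ?_
  obtain ⟨φ, hφ, hlt⟩ := hu.2 ε hε
  have hφ0 : u =ᵐ[volume.restrict (nlDomain Ω δ \ Ω)] u - φ := by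
    filter_upwards [ae_restrict_mem ((isOpen_nlDomain Ω δ).measurableSet.diff hΩ)] with x hx
    have : φ x = 0 := image_eq_zero_of_notMem_tsupport fun h => hx.2 (hφ.2.2 h)
    simp [this]
  rw [eLpNorm_congr_ae hφ0]
  refine lt_of_le_of_lt ?_ hlt
  refine le_add_right ?_
  gcongr

lemma exists_measurable_eq_zero_off {n : ℕ} {A : ℝ → ℝ → ℝ} {Ω : Set (RSpace n)}
    (hΩ : MeasurableSet Ω) {δ : ℝ} {u : RSpace n → ℝ} (hu : u ∈ nlSpaceZero A Ω δ) :
    ∃ v : RSpace n → ℝ, Measurable v ∧ (∀ x ∉ Ω, v x = 0) ∧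
      u =ᵐ[volume.restrict (nlDomain Ω δ)] v := by
  refine ⟨Ω.indicator (hu.1.1.1.mk u), hu.1.1.1.stronglyMeasurable_mk.measurable.indicator hΩ,
    fun x hx => Set.indicator_of_notMem hx _, ?_⟩
  have hS := (isOpen_nlDomain Ω δ).measurableSet
  have h0 := ae_eq_zero_of_mem_nlSpaceZero hΩ hu
  have h0' := (ae_restrict_iff' (hS.diff hΩ)).1 h0
  filter_upwards [hu.1.1.1.ae_eq_mk, ae_restrict_of_ae h0', ae_restrict_mem hS] with x h1 h2 h3
  by_cases hx : x ∈ Ω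
  · rw [Set.indicator_of_mem hx, ← h1]
  · rw [Set.indicator_of_notMem hx]
    exact h2 ⟨h3, hx⟩

/-- Nonlocal energies on all of `ℝⁿ`, as superpositions of squared norms of difference
functions. -/
lemma lintegral_lintegral_translation {n : ℕ} {G : RSpace n → ℝ≥0∞} (hG : AEMeasurable G)
    {v : RSpace n → ℝ} (hv : Measurable v) :
    ∫⁻ x, ∫⁻ x', G (x - x') * ‖v x - v x'‖ₑ ^ 2
      = ∫⁻ h, G h * eLpNorm (fun x => v x - v (x - h)) 2 volume ^ 2 := by
  have hchange : ∀ x, ∫⁻ x', G (x - x') * ‖v x - v x'‖ₑ ^ 2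
      = ∫⁻ h, hG.mk G h * ‖v x - v (x - h)‖ₑ ^ 2 := fun x => by
    rw [← lintegral_sub_left_eq_self (fun x' => G (x - x') * ‖v x - v x'‖ₑ ^ 2) x]
    refine lintegral_congr_ae ?_
    filter_upwards [hG.ae_eq_mk] with h hh
    rw [sub_sub_cancel, hh]
  simp_rw [hchange]
  rw [lintegral_lintegral_swap]
  · refine lintegral_congr_ae ?_
    filter_upwards [hG.ae_eq_mk] with h hh
    have hm : Measurable fun x => ‖v x - v (x - h)‖ₑ ^ 2 :=
      (hv.sub (hv.comp (measurable_id.sub_const h))).enorm.pow_const 2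
    rw [lintegral_const_mul _ hm, hh]
    congr 1
    simpa using (eLpNorm_nnreal_pow_eq_lintegral (f := fun x => v x - v (x - h))
      (μ := volume) (p := 2) two_ne_zero).symm
  · refine Measurable.aemeasurable ?_
    refine (hG.measurable_mk.comp measurable_snd).mul (Measurable.pow_const ?_ 2)
    exact ((hv.comp measurable_fst).sub (hv.comp (measurable_fst.sub measurable_snd))).enorm

/-- For a function vanishing off `Ω`, restricting the double integral to `Ω_δ × Ω_δ` loses nothing:
a pair of points at distance less than `δ`, not both in `Ω_δ`, lies entirely off `Ω`. -/
lemma nlEnergy_eq_lintegral_translation {n : ℕ} {A : ℝ → ℝ → ℝ} {Ω : Set (RSpace n)} {δ : ℝ}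
    (hAm : AEMeasurable fun x : RSpace n => A δ ‖x‖)
    (hsupp : Function.support (fun x : RSpace n => A δ ‖x‖) ⊆ Metric.ball 0 δ) (hδ : 0 < δ)
    {v : RSpace n → ℝ} (hv : Measurable v) (hv0 : ∀ x ∉ Ω, v x = 0) :
    nlEnergy A Ω δ v = ∫⁻ h : RSpace n, ENNReal.ofReal (A δ ‖h‖ / ‖h‖ ^ 2)
      * eLpNorm (fun x => v x - v (x - h)) 2 volume ^ 2 := by
  have hS := (isOpen_nlDomain Ω δ).measurableSet
  have hG : AEMeasurable fun h : RSpace n => ENNReal.ofReal (A δ ‖h‖ / ‖h‖ ^ 2) :=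
    (hAm.div (measurable_norm.pow_const 2).aemeasurable).ennreal_ofReal
  rw [← lintegral_lintegral_translation hG hv, nlEnergy, ← lintegral_indicator hS]
  refine lintegral_congr fun x => ?_
  have hform : ∀ x', ENNReal.ofReal (A δ ‖x - x'‖ * ((v x - v x') / ‖x - x'‖) ^ 2)
      = ENNReal.ofReal (A δ ‖x - x'‖ / ‖x - x'‖ ^ 2) * ‖v x - v x'‖ₑ ^ 2 := fun x' => by
    rw [← ofReal_norm, ← ENNReal.ofReal_pow (norm_nonneg _), Real.norm_eq_abs, sq_abs,
      ← ENNReal.ofReal_mul' (sq_nonneg _)]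
    congr 1
    ring
  have hzero : ∀ x', (x ∉ nlDomain Ω δ ∨ x' ∉ nlDomain Ω δ) →
      ENNReal.ofReal (A δ ‖x - x'‖ / ‖x - x'‖ ^ 2) * ‖v x - v x'‖ₑ ^ 2 = 0 := fun x' hx => by
    by_cases hAx : A δ ‖x - x'‖ = 0
    · simp [hAx]
    have hd : dist x x' < δ := by
      have : x - x' ∈ Metric.ball (0 : RSpace n) δ := hsupp hAx
      rwa [mem_ball_zero_iff, ← dist_eq_norm] at this
    have hxΩ : x ∉ Ω := fun h => hx.elim (fun h' => h' (subset_nlDomain hδ h))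
      fun h' => h' (Set.mem_biUnion h (Metric.mem_ball'.2 hd))
    have hxΩ' : x' ∉ Ω := fun h => hx.elim
      (fun h' => h' (Set.mem_biUnion h (Metric.mem_ball.2 hd)))
      fun h' => h' (subset_nlDomain hδ h)
    simp [hv0 _ hxΩ, hv0 _ hxΩ']
  by_cases hx : x ∈ nlDomain Ω δ
  · rw [Set.indicator_of_mem hx, ← lintegral_indicator hS]
    refine lintegral_congr fun x' => ?_
    by_cases hx' : x' ∈ nlDomain Ω δ
    · rw [Set.indicator_of_mem hx', hform]
    · rw [Set.indicator_of_notMem hx', hzero x' (Or.inr hx')]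
  · rw [Set.indicator_of_notMem hx]
    simp [hzero _ (Or.inl hx)]

lemma IsAdmissibleKernel.integral_eq {n : ℕ} {A : ℝ → ℝ → ℝ} (hA : IsAdmissibleKernel n A)
    {δ : ℝ} (hδ : 0 < δ) : ∫ x : RSpace n, A δ ‖x‖ = n := by
  have h := hA.normalized δ hδ
  have hn : (n : ℝ) ≠ 0 := fun h0 => by simp [h0] at h
  field_simp at h
  exact h

lemma IsAdmissibleKernel.integrable {n : ℕ} {A : ℝ → ℝ → ℝ} (hA : IsAdmissibleKernel n A)
    {δ : ℝ} (hδ : 0 < δ) : Integrable fun x : RSpace n => A δ ‖x‖ := by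
  by_contra hni
  have h := hA.normalized δ hδ
  simp [integral_undef hni] at h

/-- Poincaré inequality for measurable functions vanishing off `Ω`, with a constant that is uniform
in `δ ≤ r`. -/
lemma eLpNorm_sq_le_nlEnergy {n : ℕ} (hn : 1 ≤ n) {A : ℝ → ℝ → ℝ} (hA : IsAdmissibleKernel n A)
    {Ω : Set (RSpace n)} (hΩb : Bornology.IsBounded Ω) {δ r : ℝ} (hδ : 0 < δ) (hr : δ ≤ r)
    {v : RSpace n → ℝ} (hv : Measurable v) (hv0 : ∀ x ∉ Ω, v x = 0) :
    eLpNorm v 2 volume ^ 2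
      ≤ ENNReal.ofReal (Metric.diam Ω + r) ^ 2 * nlEnergy A Ω δ v := by
  have hmass : ∫⁻ h : RSpace n, ENNReal.ofReal (A δ ‖h‖) = n := by
    rw [← ofReal_integral_eq_lintegral_ofReal (hA.integrable hδ)
      (Filter.Eventually.of_forall fun x => hA.nonneg δ hδ _ (norm_nonneg x)), hA.integral_eq hδ,
      ENNReal.ofReal_natCast]
  rw [nlEnergy_eq_lintegral_translation (hA.integrable hδ).aemeasurable
    (hA.support_subset δ hδ) hδ hv hv0, ← lintegral_const_mul' _ _ (by finiteness)]
  calc eLpNorm v 2 volume ^ 2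
      ≤ (∫⁻ h : RSpace n, ENNReal.ofReal (A δ ‖h‖)) * eLpNorm v 2 volume ^ 2 := by
        rw [hmass]
        exact le_mul_of_one_le_left zero_le (by exact_mod_cast hn)
    _ = ∫⁻ h : RSpace n, ENNReal.ofReal (A δ ‖h‖) * eLpNorm v 2 volume ^ 2 :=
        (lintegral_mul_const'' _ (hA.integrable hδ).aemeasurable.ennreal_ofReal).symm
    _ ≤ _ := by
        have : Nonempty (Fin n) := ⟨⟨0, hn⟩⟩
        refine lintegral_mono_ae ?_
        -- The weight `A_δ(|h|) / |h|²` has the junk value `0` at `h = 0`, a null set.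
        filter_upwards [Measure.ae_ne volume (0 : RSpace n)] with h hne
        by_cases hAh : A δ ‖h‖ = 0
        · simp [hAh]
        have hh : ‖h‖ ≤ r := by
          have : h ∈ Metric.ball (0 : RSpace n) δ := hA.support_subset δ hδ hAh
          exact (mem_ball_zero_iff.1 this).le.trans hr
        have hpos : 0 < ‖h‖ := norm_pos_iff.2 hne
        have hsplit : ENNReal.ofReal (A δ ‖h‖)
            = ENNReal.ofReal (A δ ‖h‖ / ‖h‖ ^ 2) * ENNReal.ofReal ‖h‖ ^ 2 := by
          rw [← ENNReal.ofReal_pow hpos.le, ← ENNReal.ofReal_mul' (sq_nonneg _),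
            div_mul_cancel₀ _ (pow_pos hpos 2).ne']
        rw [hsplit, mul_assoc, ← mul_pow, mul_left_comm, ← mul_pow]
        exact mul_le_mul_right
          (pow_le_pow_left' (norm_mul_eLpNorm_le_translation hΩb hv hv0 hh) 2) _

theorem mainTheorem8 (n : ℕ) (hn : 2 ≤ n) (Ω : Set (RSpace n)) (hΩo : IsOpen Ω)
    (hΩb : Bornology.IsBounded Ω) (hΩc : IsConnected Ω)
    (A : ℝ → ℝ → ℝ) (hA : IsAdmissibleKernel n A) (δ₀ : ℝ) (hδ₀ : 0 < δ₀) :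
    ∃ δhat : ℝ, 0 < δhat ∧ δhat < δ₀ ∧ ∃ C : ℝ, 0 < C ∧
      ∀ δ : ℝ, 0 < δ → δ < δhat → ∀ u ∈ nlSpaceZero A Ω δ,
        C * l2Norm Ω u ≤ nlNorm A Ω δ u := by
  have hK : 0 < Metric.diam Ω + δ₀ := add_pos_of_nonneg_of_pos Metric.diam_nonneg hδ₀
  refine ⟨δ₀ / 2, half_pos hδ₀, half_lt_self hδ₀, (Metric.diam Ω + δ₀)⁻¹, inv_pos.2 hK,
    fun δ hδ hδ' u hu => ?_⟩
  obtain ⟨v, hv, hv0, huv⟩ := exists_measurable_eq_zero_off hΩo.measurableSet hu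
  have hnorm : eLpNorm u 2 (volume.restrict Ω) ≤ eLpNorm v 2 volume := by
    rw [eLpNorm_congr_ae (ae_restrict_of_ae_restrict_of_subset (subset_nlDomain hδ) huv)]
    exact eLpNorm_mono_measure _ Measure.restrict_le_self
  have hmain : eLpNorm u 2 (volume.restrict Ω) ^ 2
      ≤ ENNReal.ofReal (Metric.diam Ω + δ₀) ^ 2 * nlEnergy A Ω δ u := by
    rw [nlEnergy_congr_ae huv]
    refine le_trans (by gcongr) (eLpNorm_sq_le_nlEnergy (by omega) hA hΩb hδ
      (by linarith : δ ≤ δ₀) hv hv0)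
  have hreal := ENNReal.toReal_mono (ENNReal.mul_ne_top (by finiteness) hu.1.2.ne) hmain
  rw [ENNReal.toReal_mul, ENNReal.toReal_pow, ENNReal.toReal_pow, ENNReal.toReal_ofReal hK.le]
    at hreal
  rw [inv_mul_le_iff₀ hK, l2Norm, nlNorm]
  refine le_of_sq_le_sq ?_ (by positivity)
  rwa [mul_pow, Real.sq_sqrt ENNReal.toReal_nonneg]
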